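/- Let $X$ be a proper CAT(0) space with boundary at infinity $\partial_\infty X$; equip $\partial_\infty X$ and $X\cup\partial_\infty X$ with the cone topology. For $A\subseteq X$ let $\partial_\infty A$ be the set of endpoints of geodesic rays contained in $A$. A halfspace is an open convex $h\subseteq X$ such that $h^*=X\smallsetminus\overline h$ is convex (the trivial halfspaces $\varnothing, X$ are allowed); its wall is $W(h)=\overline h\cap\overline{h^*}$. A halfspace system is a family $\mathcal H$ of halfspaces, ordered by inclusion, containing $\varnothing$ and $X$, closed under $h\mapsto h^*$, with $h^{**}=h$ for all $h\in\mathcal H$, such that every point of $X$ has a neighbourhood meeting only finitely many walls of $\mathcal H$, and such that $\mathcal H$ has no infinite subfamily of pairwise transverse elements ($h,k$ are transverse if none of $h\subseteq k$, $h^*\subseteq k$, $h\subseteq k^*$, $h^*\subseteq k^*$ holds). An ultrafilter on $\mathcal H$ is a subset $\alpha\subseteq\mathcal H$ containing exactly one of $h,h^*$ for each $h\in\mathcal H$ and containing no $h,k$ with $h\subseteq k^*$; it is principal if it contains no infinite strictly descending chain. The set $\mathcal H^\circ$ of ultrafilters has the topology with sub-base $\{\alpha: h\in\alpha\}$, $h\in\mathcal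 H$. Two ultrafilters are almost equal if their symmetric difference is finite. The Roller boundary $\Re\mathcal H$ is the set of almost-equality classes, ordered by: $\Sigma_1\le\Sigma$ iff $\Sigma\cap\overline{\Sigma_1}\neq\varnothing$. The codimension of $\Sigma$ is the number of classes of infinite strictly descending chains contained in some (equivalently, any) $\alpha\in\Sigma$, where $(c_n)$ and $(d_m)$ are equivalent if each $d_m$ contains some $c_n$ and each $c_n$ contains some $d_m$. For $\xi\in\partial_\infty X$ let $\mathcal H^\xi$ be the set of $\sigma\in\mathcal H^\circ$ with $\xi\in\partial_\infty\overline h$ for all $h\in\sigma$, let $\Re(\xi)$ be the set of almost-equality classes meeting $\mathcal H^\xi$, and let $T(\xi)=\{h\in\mathcal H:\xi\in\partial_\infty\overline h\smallsetminus\partial_\infty W(h)\}$. The boundary decomposition map $\rho:\partial_\infty X\to\Re\mathcal H$ sends $\xi$ to the minimum element of $\Re(\xi)$. The system $\mathcal H$ is uniform if for every $\xi\in\partial_\infty X$ the set $T(\xi)$ is non-empty and for all $a\in T(\xi)$ and every neighbourhood $U$ of $\xi$ in $X\cup\partial_\infty X$ there is $b\in T(\xi)$ with $b\subsetneq a$ and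 $b^*\cap U\ne\varnothing$. Suppose $\mathcal H$ is a uniform halfspace system in $X$. Then every $\Re(\xi)$ has a minimum, so that $\rho$ is defined, and for every $\Sigma\in\Re\mathcal H$ in the image of $\rho$, $$\overline{\rho^{-1}(\Sigma)}\subseteq\bigcup_{\Sigma_1\le\Sigma}\rho^{-1}(\Sigma_1).$$ Moreover $\rho^{-1}(\Sigma)=\varnothing$ if $\Sigma$ contains a principal ultrafilter; and, in particular, $\rho^{-1}(\Sigma)$ is closed for every $\Sigma\in\Re\mathcal H$ of codimension $1$. -/

import Mathlib

open Set Topology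
open scoped NNReal

/-! ### Poc-sets, ultrafilters and the Roller boundary -/

/-- A poc-set: a partially ordered set with a minimum `⊥` and an order-reversing involution
`h ↦ h*` such that `h ≤ h*` only for `h = ⊥`. -/
class PocSet (H : Type*) extends PartialOrder H, OrderBot H where
  pstar : H → H
  pstar_pstar : ∀ h : H, pstar (pstar h) = h
  pstar_le_pstar : ∀ h k : H, h ≤ k → pstar k ≤ pstar h
  eq_bot_of_le_pstar : ∀ h : H, h ≤ pstar h → h = ⊥

namespace PocSet

/-- Ultrafilters on a poc-set. -/
@[ext] structure UF (H : Type*) [PocSet H] where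
  carrier : Set H
  /-- for every `h`, either `h` or `h*` belongs to the ultrafilter, but not both -/
  uf1 : ∀ h : H, Xor (h ∈ carrier) (pstar h ∈ carrier)
  /-- no two elements `h, k` satisfy `h ≤ k*` -/
  uf2 : ∀ h ∈ carrier, ∀ k ∈ carrier, ¬ h ≤ pstar k

variable {H : Type*} [PocSet H]

/-- The Tychonoff topology: the sets `S_h = {α | h ∈ α}` form a sub-base. -/
instance : TopologicalSpace (UF H) :=
  TopologicalSpace.generateFrom {S | ∃ h : H, S = {α : UF H | h ∈ α.carrier}}

/-- Almost equality: the symmetric difference is finite. -/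
instance almostEq (H : Type*) [PocSet H] : Setoid (UF H) where
  r α β := (symmDiff α.carrier β.carrier).Finite
  iseqv :=
    { refl := fun α => by simp
      symm := fun {α β} h => by rwa [symmDiff_comm]
      trans := fun {α β γ} h₁ h₂ =>
        (h₁.union h₂).subset (symmDiff_triangle α.carrier β.carrier γ.carrier) }

/-- The Roller boundary: the set of all almost-equality classes of ultrafilters. -/
def Roller (H : Type*) [PocSet H] : Type _ := Quotient (almostEq H)

/-- The almost-equality class of an ultrafilter. -/
def cls (α : UF H) : Roller H := Quotient.mk (almostEq H) α

/-- An element of the Roller boundary, as a set of ultrafilters. -/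
def Roller.toSet (S : Roller H) : Set (UF H) := {α | cls α = S}

/-- The order of the Roller boundary: `S₂ ≤ S₁` iff `S₁` meets the closure of `S₂`. -/
instance : LE (Roller H) where
  le S₂ S₁ := (S₁.toSet ∩ closure S₂.toSet).Nonempty

/-- The descending chain condition. -/
def UF.IsPrincipal (α : UF H) : Prop :=
  ∀ c : ℕ → H, (∀ n, c n ∈ α.carrier) → (∀ n, c (n + 1) ≤ c n) →
    ∃ N, ∀ n ≥ N, c (n + 1) = c n

/-- Infinite (strictly) descending chains. -/
def Chain (H : Type*) [PocSet H] : Type _ := {c : ℕ → H // StrictAnti c}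

/-- `c` dominates `d`. -/
def Chain.Dominates (c d : Chain H) : Prop := ∀ m, ∃ n, c.1 n ≤ d.1 m

/-- Two chains are equivalent if each dominates the other. -/
def Chain.setoid (H : Type*) [PocSet H] : Setoid (Chain H) where
  r c d := c.Dominates d ∧ d.Dominates c
  iseqv :=
    { refl := fun c => ⟨fun m => ⟨m, le_rfl⟩, fun m => ⟨m, le_rfl⟩⟩
      symm := fun h => ⟨h.2, h.1⟩
      trans := fun h₁ h₂ =>
        ⟨fun m => by
          obtain ⟨n, hn⟩ := h₂.1 m
          obtain ⟨k, hk⟩ := h₁.1 n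
          exact ⟨k, hk.trans hn⟩,
        fun m => by
          obtain ⟨n, hn⟩ := h₁.2 m
          obtain ⟨k, hk⟩ := h₂.2 n
          exact ⟨k, hk.trans hn⟩⟩ }

/-- The infinite descending chains contained in an ultrafilter. -/
def UF.chains (α : UF H) : Set (Chain H) := {c | ∀ n, c.1 n ∈ α.carrier}

theorem UF.mem_of_le (α : UF H) {h k : H} (hh : h ∈ α.carrier) (hk : h ≤ k) :
    k ∈ α.carrier := by
  by_contra hn
  rcases α.uf1 k with ⟨h1, -⟩ | ⟨h1, -⟩
  · exact hn h1
  · exact α.uf2 h hh _ h1 (by rwa [pstar_pstar])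

theorem UF.chains_subset (α β : UF H) (h : α ≈ β) : α.chains ⊆ β.chains := by
  intro c hc n
  have hfin : (symmDiff α.carrier β.carrier).Finite := h
  have hinf : (c.1 '' Set.Ici n).Infinite :=
    (Set.Ici_infinite n).image c.2.injective.injOn
  obtain ⟨x, ⟨m, hm, rfl⟩, hx⟩ := hinf.exists_notMem_finite hfin
  have hmβ : c.1 m ∈ β.carrier := by
    by_contra hb
    exact hx (Or.inl ⟨hc m, hb⟩)
  exact β.mem_of_le hmβ (c.2.antitone hm)

/-- The codimension of an almost-equality class: the number of equivalence classes of infinite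
descending chains contained in any of its elements. -/
noncomputable def Roller.codim (S : Roller H) : Cardinal :=
  Quotient.lift
    (fun α : UF H => Cardinal.mk ((Quotient.mk (Chain.setoid H)) '' α.chains : Set _))
    (fun α β h => by
      have e : α.chains = β.chains :=
        Set.Subset.antisymm (UF.chains_subset α β h) (UF.chains_subset β α (Setoid.symm h))
      simp only [e]) S

/-- Ultrafilters exist as soon as the two trivial elements are distinct. -/
theorem UF.nonempty_of_ne (hne : (⊥ : H) ≠ pstar ⊥) : Nonempty (UF H) := by
  have swap : ∀ h k : H, h ≤ pstar k → k ≤ pstar h := fun h k hk => by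
    have := pstar_le_pstar _ _ hk
    rwa [pstar_pstar] at this
  obtain ⟨α, hα⟩ := zorn_subset {α : Set H | ∀ h ∈ α, ∀ k ∈ α, ¬ h ≤ pstar k} (by
    intro c hc hchain
    refine ⟨⋃₀ c, ?_, fun s hs => Set.subset_sUnion_of_mem hs⟩
    rintro h ⟨s, hs, hhs⟩ k ⟨t, ht, hkt⟩
    rcases hchain.total hs ht with hst | hts
    · exact hc ht h (hst hhs) k hkt
    · exact hc hs h hhs k (hts hkt))
  have hbase : ∀ h ∈ α, ∀ k ∈ α, ¬ h ≤ pstar k := hα.prop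
  -- an element that does not belong to the maximal filter base `α` is an obstruction
  have key : ∀ h : H, h ∉ α → h = ⊥ ∨ ∃ k ∈ α, h ≤ pstar k := by
    intro h hh
    by_contra hcon
    push Not at hcon
    refine hh (hα.le_of_ge (y := insert h α) ?_ (Set.subset_insert _ _) (Set.mem_insert _ _))
    rintro x (rfl | hx) y (rfl | hy)
    · exact fun hle => hcon.1 (eq_bot_of_le_pstar _ hle)
    · exact hcon.2 y hy
    · exact fun hle => hcon.2 x hx (swap _ _ hle)
    · exact hbase x hx y hy
  refine ⟨⟨α, fun h => ?_, hbase⟩⟩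
  by_cases h1 : h ∈ α
  · exact Or.inl ⟨h1, fun h2 => hbase h h1 _ h2 (by rw [pstar_pstar])⟩
  · refine Or.inr ⟨?_, h1⟩
    by_contra h2
    rcases key h h1 with rfl | ⟨k, hk, hhk⟩ <;> rcases key _ h2 with h3 | ⟨l, hl, hhl⟩
    · exact hne h3.symm
    · have hl0 : l ≤ ⊥ := by
        have := pstar_le_pstar _ _ hhl
        rwa [pstar_pstar, pstar_pstar] at this
      exact hbase l hl l hl (hl0.trans bot_le)
    · have hk0 : k ≤ ⊥ := h3 ▸ swap _ _ hhk
      exact hbase k hk k hk (hk0.trans bot_le)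
    · have hlh : l ≤ h := by
        have := pstar_le_pstar _ _ hhl
        rwa [pstar_pstar, pstar_pstar] at this
      exact hbase l hl k hk (hlh.trans hhk)

end PocSet

/-! ### CAT(0) spaces, the visual boundary and the cone topology -/

/-- A CAT(0) space: a geodesic metric space in which geodesic triangles are not thicker than their
Euclidean comparison triangles. (In a geodesic space, `x` lies on a geodesic segment from `p` to
`q` iff `d(p,x) + d(x,q) = d(p,q)`.) -/
class CAT0Space (X : Type*) [MetricSpace X] : Prop where
  geodesic : ∀ x y : X, ∃ γ : ℝ → X, γ 0 = x ∧ γ (dist x y) = y ∧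
    ∀ s ∈ Icc 0 (dist x y), ∀ t ∈ Icc 0 (dist x y), dist (γ s) (γ t) = |s - t|
  comparison : ∀ (p q r x y : X) (p' q' r' x' y' : EuclideanSpace ℝ (Fin 2)),
    dist p x + dist x q = dist p q → dist p y + dist y r = dist p r →
    dist p' q' = dist p q → dist q' r' = dist q r → dist p' r' = dist p r →
    dist p' x' = dist p x → dist x' q' = dist x q →
    dist p' y' = dist p y → dist y' r' = dist y r →
    dist x y ≤ dist x' y'

/-- Geodesic convexity: `A` contains every geodesic segment with endpoints in `A`. -/
def GeodConvex {X : Type*} [MetricSpace X] (A : Set X) : Prop :=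
  ∀ x ∈ A, ∀ y ∈ A, ∀ z, dist x z + dist z y = dist x y → z ∈ A

/-- Unit speed geodesic rays. -/
structure GeodRay (X : Type*) [MetricSpace X] where
  toFun : ℝ≥0 → X
  isometry : Isometry toFun

/-- Two rays are asymptotic if they stay within bounded distance of each other. -/
def GeodRay.setoid (X : Type*) [MetricSpace X] : Setoid (GeodRay X) where
  r c d := ∃ K : ℝ, ∀ t, dist (c.toFun t) (d.toFun t) ≤ K
  iseqv :=
    { refl := fun c => ⟨0, fun t => by simp⟩
      symm := fun {c d} ⟨K, hK⟩ => ⟨K, fun t => by rw [dist_comm]; exact hK t⟩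
      trans := fun {c d e} ⟨K, hK⟩ ⟨L, hL⟩ =>
        ⟨K + L, fun t => (dist_triangle _ _ _).trans (add_le_add (hK t) (hL t))⟩ }

/-- The boundary at infinity `∂∞ X`. -/
def BdryInf (X : Type*) [MetricSpace X] : Type _ := Quotient (GeodRay.setoid X)

/-- The endpoint `c(∞)` of a ray. -/
def GeodRay.endpoint {X : Type*} [MetricSpace X] (c : GeodRay X) : BdryInf X :=
  Quotient.mk (GeodRay.setoid X) c

/-- `∂∞ A`: the endpoints of the geodesic rays contained in `A`. -/
def bdryOf {X : Type*} [MetricSpace X] (A : Set X) : Set (BdryInf X) :=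
  {ξ | ∃ c : GeodRay X, c.endpoint = ξ ∧ ∀ t, c.toFun t ∈ A}

/-- The bordification `X ∪ ∂∞ X`. -/
inductive Bordification (X : Type*) [MetricSpace X] where
  | inner (x : X) : Bordification X
  | ideal (ξ : BdryInf X) : Bordification X

/-- The basic set `U(c, r, ε)`: all points `z` at distance more than `r` from `c(0)` such that the
point at distance `r` from `c(0)` on the geodesic segment (or ray) from `c(0)` to `z` is at distance
less than `ε` from `c(r)`. -/
def coneNhd {X : Type*} [MetricSpace X] (c : GeodRay X) (r : ℝ≥0) (ε : ℝ) :
    Set (Bordification X) :=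
  {z | match z with
    | .inner x => (r : ℝ) < dist (c.toFun 0) x ∧ ∃ y, dist (c.toFun 0) y = r ∧
        dist (c.toFun 0) y + dist y x = dist (c.toFun 0) x ∧ dist y (c.toFun r) < ε
    | .ideal ξ => ∃ c' : GeodRay X, c'.endpoint = ξ ∧ c'.toFun 0 = c.toFun 0 ∧
        dist (c'.toFun r) (c.toFun r) < ε}

/-- The cone topology on `X ∪ ∂∞ X`, generated by the open subsets of `X` and the sets
`U(c, r, ε)`. -/
instance (X : Type*) [MetricSpace X] : TopologicalSpace (Bordification X) :=
  TopologicalSpace.generateFrom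
    ({S | ∃ V : Set X, IsOpen V ∧ S = Bordification.inner '' V} ∪
      {S | ∃ (c : GeodRay X) (r : ℝ≥0) (ε : ℝ), 0 < r ∧ 0 < ε ∧ S = coneNhd c r ε})

/-- The cone topology on `∂∞ X`. -/
instance (X : Type*) [MetricSpace X] : TopologicalSpace (BdryInf X) :=
  TopologicalSpace.induced Bordification.ideal inferInstance

/-! ### Halfspace systems and the boundary decomposition map -/

/-- `h* = X ∖ cl h`. -/
def hstar {X : Type*} [MetricSpace X] (h : Set X) : Set X := (closure h)ᶜ

/-- The wall `W(h) = cl h ∩ cl h*`. -/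
def wall {X : Type*} [MetricSpace X] (h : Set X) : Set X := closure h ∩ closure (hstar h)

/-- Halfspaces: open convex sets `h` such that `h*` is convex. The empty set is allowed: it is one
of the two trivial halfspaces `∅` and `X`. -/
def IsHalfspace {X : Type*} [MetricSpace X] (h : Set X) : Prop :=
  IsOpen h ∧ GeodConvex h ∧ GeodConvex (hstar h)

/-- Halfspace systems. The operation `h ↦ h*` is required to be an involution, so that the system
is a poc-set. -/
structure HalfspaceSystem (X : Type*) [MetricSpace X] where
  carrier : Set (Set X)
  isHalfspace : ∀ h ∈ carrier, IsHalfspace h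
  empty_mem : ∅ ∈ carrier
  univ_mem : univ ∈ carrier
  hstar_mem : ∀ h ∈ carrier, hstar h ∈ carrier
  hstar_hstar : ∀ h ∈ carrier, hstar (hstar h) = h
  /-- every point has a neighbourhood meeting only finitely many walls -/
  locallyFinite : ∀ x : X, ∃ U ∈ 𝓝 x,
    {W : Set X | (∃ h ∈ carrier, W = wall h) ∧ (W ∩ U).Nonempty}.Finite
  /-- there is no infinite transverse subfamily -/
  omegaDim : ∀ S ⊆ carrier,
    (S.Pairwise fun h k => ¬ h ⊆ k ∧ ¬ hstar h ⊆ k ∧ ¬ h ⊆ hstar k ∧ ¬ hstar h ⊆ hstar k) →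
    S.Finite

namespace HalfspaceSystem

open PocSet

variable {X : Type*} [MetricSpace X]

/-- A halfspace system is a poc-set with respect to inclusion and `h ↦ h*`. -/
instance (H : HalfspaceSystem X) : PocSet H.carrier where
  toPartialOrder := inferInstance
  bot := ⟨∅, H.empty_mem⟩
  bot_le h := Set.empty_subset h.1
  pstar h := ⟨hstar h.1, H.hstar_mem h.1 h.2⟩
  pstar_pstar h := Subtype.ext (H.hstar_hstar h.1 h.2)
  pstar_le_pstar h k hk := by
    change (closure k.1)ᶜ ⊆ (closure h.1)ᶜ
    exact Set.compl_subset_compl.2 (closure_mono hk)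
  eq_bot_of_le_pstar h hh := by
    refine Subtype.ext (Set.eq_empty_of_forall_notMem fun x hx => ?_)
    have hh' : h.1 ⊆ (closure h.1)ᶜ := hh
    exact hh' hx (subset_closure hx)

/-- `H^ξ`: the ultrafilters all of whose elements `h` satisfy `ξ ∈ ∂∞ cl h`. -/
def ultrafiltersAt (H : HalfspaceSystem X) (ξ : BdryInf X) : Set (UF H.carrier) :=
  {σ | ∀ h ∈ σ.carrier, ξ ∈ bdryOf (closure h.1)}

/-- `T(ξ)`: the elements `h` with `ξ ∈ ∂∞ cl h ∖ ∂∞ W(h)`. -/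
def T (H : HalfspaceSystem X) (ξ : BdryInf X) : Set H.carrier :=
  {h | ξ ∈ bdryOf (closure h.1) \ bdryOf (wall h.1)}

/-- `ℜ(ξ)`: the almost-equality classes represented in `H^ξ`. -/
def rollerAt (H : HalfspaceSystem X) (ξ : BdryInf X) : Set (Roller H.carrier) :=
  cls '' H.ultrafiltersAt ξ

theorem nonempty_roller (H : HalfspaceSystem X) (ξ : BdryInf X) :
    Nonempty (Roller H.carrier) := by
  have hne : (⊥ : H.carrier) ≠ pstar ⊥ := by
    intro h
    have h' : (∅ : Set X) = (closure ∅)ᶜ := congrArg Subtype.val h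
    induction ξ using Quotient.inductionOn with
    | h c =>
      have : c.toFun 0 ∈ (∅ : Set X) := by rw [h']; simp
      exact this
  exact (UF.nonempty_of_ne hne).map cls

/-- The boundary decomposition map `ρ : ∂∞ X → ℜH`: `ρ(ξ)` is the minimum element of `ℜ(ξ)`. -/
noncomputable def rho (H : HalfspaceSystem X) (ξ : BdryInf X) : Roller H.carrier :=
  @Classical.epsilon _ (H.nonempty_roller ξ) fun S => IsLeast (H.rollerAt ξ) S

/-- Conical limit points. -/
def IsConical (H : HalfspaceSystem X) (ξ : BdryInf X) : Prop :=
  (H.T ξ).Nonempty ∧ ∀ a ∈ H.T ξ, ∀ U ∈ 𝓝 (Bordification.ideal ξ),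
    ∃ b ∈ H.T ξ, b < a ∧ ∃ x ∈ hstar b.1, Bordification.inner x ∈ U

/-- Uniform halfspace systems: all boundary points are conical limit points. -/
def IsUniform (H : HalfspaceSystem X) : Prop := ∀ ξ : BdryInf X, H.IsConical ξ

end HalfspaceSystem

/-!
Everything rests on one reformulation: in a proper CAT(0) space, `h ∈ T(ξ)` iff `ξ ∉ ∂∞ cl h*`
(`HalfspaceSystem.mem_T_iff`). Thales' inequality `CAT0Space.dist_le_mul` shows that a closed convex
set whose boundary contains `ξ` contains the whole ray to `ξ` from each of its points
(`mem_of_endpoint_mem_bdryOf`). Hence `∂∞ W(h) = ∂∞ cl h ∩ ∂∞ cl h*`, which gives the reformulation,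
and `∂∞ cl h*` is closed in the cone topology, so that `h ∈ T(ξ)` is an open condition on `ξ`.

Therefore `T(ξ)` is an upward closed set without complementary pairs, and `H^ξ` consists of the
ultrafilters containing it. An ultrafilter `α` of halfspaces around a fixed point of `X` contains
all but finitely many of the elements above any `h ≠ ∅`, because two points are separated by
finitely many walls. Forcing `α` to contain `T(ξ)` (`PocSet.UF.force`) then yields an element of
`H^ξ` whose class is dense in `H^ξ`: this class is the minimum of `ℜ(ξ)`.

If `ξ` is conical, then `T(ξ)` has no minimal element, so each of its elements lies above an
infinite descending chain in `T(ξ)`. Almost equal ultrafilters contain the same such chains,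
so `T(ξ)` lies in every element of `ρ(ξ)`, and no element of `ρ(ξ)` is principal. If `ξ` is a limit of points
`η` with `ρ(η) = Σ`, then each `a ∈ T(ξ)` belongs to `T(η)` for some such `η`, hence to every
element of `Σ`. Thus `Σ ∈ ℜ(ξ)` and `ρ(ξ) ≤ Σ`.

For classes of codimension one it remains to see that `cls α ≤ cls σ` forces equality when `α` is
not principal. Otherwise `α ∖ σ` is infinite, and since transverse families are finite, Ramsey's
theorem yields a monotone sequence in it. A descending one is impossible, as all chains of `α` lie
in `σ`; the complements of an ascending one form a chain in `σ` that is not equivalent to any chain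
of `α`.
-/

/-! ### Geodesics and convexity in CAT(0) spaces -/

/-- Comparison triangles exist in the Euclidean plane. -/
theorem exists_euclidean_triangle {a b c : ℝ} (ha : 0 ≤ a) (hb : 0 ≤ b) (hc : 0 ≤ c)
    (hab : c ≤ a + b) (hac : b ≤ a + c) (hbc : a ≤ b + c) :
    ∃ p q r : EuclideanSpace ℝ (Fin 2), dist p q = a ∧ dist q r = c ∧ dist p r = b := by
  rcases ha.eq_or_lt with rfl | ha'
  · obtain rfl : b = c := by linarith
    exact ⟨!₂[0, 0], !₂[0, 0], !₂[b, 0], by simp,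
      by simp [EuclideanSpace.dist_eq, Real.sqrt_sq_eq_abs, abs_of_nonneg hb],
      by simp [EuclideanSpace.dist_eq, Real.sqrt_sq_eq_abs, abs_of_nonneg hb]⟩
  · -- the law of cosines gives the first coordinate of the third vertex
    obtain ⟨u, hu⟩ : ∃ u, 2 * a * u = a ^ 2 + b ^ 2 - c ^ 2 :=
      ⟨(a ^ 2 + b ^ 2 - c ^ 2) / (2 * a), by field_simp⟩
    have hub : u ≤ b := by
      refine le_of_mul_le_mul_left ?_ (by positivity : 0 < 2 * a)
      nlinarith
    have hbu : -b ≤ u := by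
      refine le_of_mul_le_mul_left ?_ (by positivity : 0 < 2 * a)
      nlinarith
    have hv : 0 ≤ b ^ 2 - u ^ 2 := by nlinarith
    refine ⟨!₂[0, 0], !₂[a, 0], !₂[u, √(b ^ 2 - u ^ 2)], ?_, ?_, ?_⟩
    · simp [EuclideanSpace.dist_eq, Real.sqrt_sq_eq_abs, abs_of_nonneg ha]
    · rw [EuclideanSpace.dist_eq, Real.sqrt_eq_iff_mul_self_eq (by positivity) hc]
      simp only [Fin.sum_univ_two, Real.dist_eq, sq_abs]
      simp [Real.sq_sqrt hv]
      linarith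
    · rw [EuclideanSpace.dist_eq, Real.sqrt_eq_iff_mul_self_eq (by positivity) hb]
      simp only [Fin.sum_univ_two, Real.dist_eq, sq_abs]
      simp [Real.sq_sqrt hv]
      ring

namespace CAT0Space

variable {X : Type*} [MetricSpace X] [CAT0Space X]

/-- Thales' inequality: the points dividing two sides of a geodesic triangle in the ratio `t`,
as seen from their common vertex, are no further apart than in Euclidean geometry. -/
theorem dist_le_mul {p q r x y : X} {t : ℝ} (ht0 : 0 ≤ t) (ht1 : t ≤ 1)
    (hx : dist p x = t * dist p q) (hx' : dist x q = (1 - t) * dist p q)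
    (hy : dist p y = t * dist p r) (hy' : dist y r = (1 - t) * dist p r) :
    dist x y ≤ t * dist q r := by
  obtain ⟨p', q', r', h1, h2, h3⟩ := exists_euclidean_triangle
    (dist_nonneg (x := p) (y := q)) (dist_nonneg (x := p) (y := r)) (dist_nonneg (x := q) (y := r))
    (by rw [dist_comm p q]; exact dist_triangle _ _ _) (dist_triangle _ _ _)
    (by rw [dist_comm q r]; exact dist_triangle _ _ _)
  have key := comparison p q r x y p' q' r' (AffineMap.lineMap p' q' t)
    (AffineMap.lineMap p' r' t) (by rw [hx, hx']; ring) (by rw [hy, hy']; ring) h1 h2 h3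
    (by rw [dist_left_lineMap, h1, hx, Real.norm_of_nonneg ht0])
    (by rw [dist_lineMap_right, h1, hx', Real.norm_of_nonneg (sub_nonneg.2 ht1)])
    (by rw [dist_left_lineMap, h3, hy, Real.norm_of_nonneg ht0])
    (by rw [dist_lineMap_right, h3, hy', Real.norm_of_nonneg (sub_nonneg.2 ht1)])
  have e : dist (AffineMap.lineMap p' q' t : EuclideanSpace ℝ (Fin 2))
      (AffineMap.lineMap p' r' t) = t * dist q' r' := by
    rw [dist_eq_norm, dist_eq_norm, ← Real.norm_of_nonneg ht0, ← norm_smul,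
      Real.norm_of_nonneg ht0]
    congr 1
    simp only [AffineMap.lineMap_apply, vsub_eq_sub, vadd_eq_add]
    module
  rwa [e, h2] at key

theorem exists_dist_eq_mul (x y : X) {t : ℝ} (ht0 : 0 ≤ t) (ht1 : t ≤ 1) :
    ∃ z, dist x z = t * dist x y ∧ dist z y = (1 - t) * dist x y := by
  obtain ⟨γ, h0, h1, hγ⟩ := geodesic x y
  have hd := dist_nonneg (x := x) (y := y)
  have ht : t * dist x y ∈ Icc 0 (dist x y) := ⟨by positivity, by nlinarith⟩
  refine ⟨γ (t * dist x y), ?_, ?_⟩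
  · have := hγ 0 ⟨le_rfl, hd⟩ _ ht
    rwa [h0, zero_sub, abs_neg, abs_of_nonneg ht.1] at this
  · have := hγ _ ht _ ⟨hd, le_rfl⟩
    rw [h1, abs_sub_comm, abs_of_nonneg (by linarith [ht.2])] at this
    rw [this]; ring

theorem _root_.GeodConvex.closure {A : Set X} (hA : GeodConvex A) : GeodConvex (closure A) := by
  intro x hx y hy z hz
  rcases eq_or_ne (dist x y) 0 with h0 | h0
  · have : dist x z = 0 := by
      linarith [dist_nonneg (x := x) (y := z), dist_nonneg (x := z) (y := y)]
    rwa [← dist_eq_zero.1 this]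
  have hpos : 0 < dist x y := lt_of_le_of_ne dist_nonneg (Ne.symm h0)
  obtain ⟨t, ht⟩ : ∃ t, dist x z = t * dist x y := ⟨dist x z / dist x y, by field_simp⟩
  have ht' : dist z y = (1 - t) * dist x y := by linarith
  have ht0 : 0 ≤ t := nonneg_of_mul_nonneg_left (ht ▸ dist_nonneg) hpos
  have ht1 : 0 ≤ 1 - t := nonneg_of_mul_nonneg_left (ht' ▸ dist_nonneg) hpos
  rw [Metric.mem_closure_iff] at hx hy ⊢
  intro ε hε
  obtain ⟨x₁, hx₁, hxx⟩ := hx (ε / 2) (half_pos hε)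
  obtain ⟨y₁, hy₁, hyy⟩ := hy (ε / 2) (half_pos hε)
  obtain ⟨w, hw, hw'⟩ := exists_dist_eq_mul x₁ y ht0 (by linarith)
  obtain ⟨z₁, hz₁, hz₁'⟩ := exists_dist_eq_mul x₁ y₁ ht0 (by linarith)
  refine ⟨z₁, hA x₁ hx₁ y₁ hy₁ z₁ (by rw [hz₁, hz₁']; ring), ?_⟩
  -- `z`, `w`, `z₁` divide the segments `[x, y]`, `[x₁, y]`, `[x₁, y₁]` in the same ratio
  have e1 : dist w z₁ ≤ t * dist y y₁ := dist_le_mul ht0 (by linarith) hw hw' hz₁ hz₁'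
  have e2 : dist z w ≤ (1 - t) * dist x x₁ := by
    refine dist_le_mul (p := y) ht1 (by linarith) ?_ ?_ ?_ ?_
    · rw [dist_comm y z, dist_comm y x, ht']
    · rw [dist_comm z x, dist_comm y x, ht]; ring
    · rw [dist_comm y w, dist_comm y x₁, hw']
    · rw [dist_comm w x₁, dist_comm y x₁, hw]; ring
  have := dist_triangle z w z₁
  nlinarith

/-- Any two points are joined by a compact connected set that lies in every geodesically convex
set containing both of them, namely a geodesic segment. -/
theorem exists_segment (x y : X) : ∃ s : Set X, IsCompact s ∧ IsPreconnected s ∧ x ∈ s ∧ y ∈ s ∧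
    ∀ A : Set X, GeodConvex A → x ∈ A → y ∈ A → s ⊆ A := by
  obtain ⟨γ, h0, h1, hγ⟩ := geodesic x y
  have hd := dist_nonneg (x := x) (y := y)
  have hcont : ContinuousOn γ (Icc 0 (dist x y)) := by
    refine (LipschitzOnWith.of_dist_le_mul (K := 1) fun s hs t ht => ?_).continuousOn
    rw [hγ s hs t ht, Real.dist_eq, NNReal.coe_one, one_mul]
  refine ⟨γ '' Icc 0 (dist x y), isCompact_Icc.image_of_continuousOn hcont,
    isPreconnected_Icc.image _ hcont, ⟨0, ⟨le_rfl, hd⟩, h0⟩, ⟨_, ⟨hd, le_rfl⟩, h1⟩, ?_⟩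
  rintro A hA hx hy _ ⟨t, ht, rfl⟩
  refine hA x hx y hy _ ?_
  have e1 := hγ 0 ⟨le_rfl, hd⟩ t ht
  have e2 := hγ t ht _ ⟨hd, le_rfl⟩
  rw [h0, zero_sub, abs_neg, abs_of_nonneg ht.1] at e1
  rw [h1, abs_sub_comm, abs_of_nonneg (by linarith [ht.2])] at e2
  rw [e1, e2]; ring

theorem _root_.GeodConvex.isPreconnected {A : Set X} (hA : GeodConvex A) : IsPreconnected A := by
  refine isPreconnected_of_forall_pair fun x hx y hy => ?_
  obtain ⟨s, -, hs, hxs, hys, h⟩ := exists_segment x y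
  exact ⟨s, h A hA hx hy, hxs, hys, hs⟩

end CAT0Space

/-! ### Geodesic rays and the boundary of a closed convex set -/

namespace GeodRay

open CAT0Space Filter

variable {X : Type*} [MetricSpace X]

theorem dist_eq (c : GeodRay X) (s t : ℝ≥0) :
    dist (c.toFun s) (c.toFun t) = |(s : ℝ) - t| := by
  rw [c.isometry.dist_eq, NNReal.dist_eq]

/-- The subray of `c` starting at `c(a)`. -/
def tail (c : GeodRay X) (a : ℝ≥0) : GeodRay X where
  toFun t := c.toFun (a + t)
  isometry := Isometry.of_dist_eq fun s t => by
    rw [c.dist_eq, NNReal.dist_eq]; push_cast; congr 1; ring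

theorem endpoint_tail (c : GeodRay X) (a : ℝ≥0) : (c.tail a).endpoint = c.endpoint := by
  refine Quotient.sound ⟨a, fun t => ?_⟩
  change dist (c.toFun (a + t)) (c.toFun t) ≤ a
  rw [c.dist_eq]; push_cast
  rw [add_sub_cancel_right, abs_of_nonneg a.coe_nonneg]

variable [CAT0Space X]

/-- A ray is determined by its starting point and its endpoint: by Thales' inequality the distance
of two rays from the same point grows at least linearly unless they agree. -/
theorem eq_of_endpoint_eq {c d : GeodRay X} (h0 : c.toFun 0 = d.toFun 0)
    (h : c.endpoint = d.endpoint) (t : ℝ≥0) : c.toFun t = d.toFun t := by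
  obtain ⟨K, hK⟩ : ∃ K : ℝ, ∀ t, dist (c.toFun t) (d.toFun t) ≤ K := Quotient.exact h
  have bound : ∀ᶠ n : ℕ in atTop, dist (c.toFun t) (d.toFun t) ≤ t * K / n := by
    filter_upwards [eventually_ge_atTop (max 1 ⌈t⌉₊)] with n hn
    have hn1 : (1 : ℝ) ≤ n := by exact_mod_cast (le_max_left _ _).trans hn
    have htn : (t : ℝ) ≤ n := by
      exact_mod_cast Nat.ceil_le.1 ((le_max_right _ _).trans hn)
    have hc : ∀ e : GeodRay X, dist (e.toFun 0) (e.toFun t) =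
        (t / n : ℝ) * dist (e.toFun 0) (e.toFun n) ∧
        dist (e.toFun t) (e.toFun n) = (1 - t / n : ℝ) * dist (e.toFun 0) (e.toFun n) := by
      intro e
      have hn0 : (n : ℝ) ≠ 0 := by positivity
      simp only [e.dist_eq, NNReal.coe_zero, NNReal.coe_natCast, zero_sub, abs_neg, Nat.abs_cast,
        NNReal.abs_eq]
      rw [abs_sub_comm, abs_of_nonneg (by linarith)]
      constructor <;> field_simp
    have := dist_le_mul (t := (t / n : ℝ)) (by positivity) (div_le_one_of_le₀ htn (by positivity))
      (hc c).1 (hc c).2 (by rw [h0]; exact (hc d).1) (by rw [h0]; exact (hc d).2)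
    calc _ ≤ _ := this
      _ ≤ (t / n : ℝ) * K := by gcongr; exact hK _
      _ = _ := by ring
  have lim : Tendsto (fun n : ℕ => t * K / n) atTop (𝓝 0) := tendsto_const_div_atTop_nhds_zero_nat _
  exact dist_le_zero.1 (ge_of_tendsto lim bound)

/-- A point `z` on the segment from `x` to `c(n)`, at distance `t` from `x`, is close to `c(t)`,
uniformly in `n` and `t`. -/
theorem dist_le_two_mul (c : GeodRay X) {x z : X} {t n : ℝ≥0} (hz : dist x z = t)
    (hz' : dist x z + dist z (c.toFun n) = dist x (c.toFun n)) :
    dist z (c.toFun t) ≤ 2 * dist x (c.toFun 0) := by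
  set L := dist x (c.toFun n) with hL
  set D := dist x (c.toFun 0) with hD
  have hn : dist (c.toFun 0) (c.toFun n) = n := by simp [c.dist_eq]
  have htL : (t : ℝ) ≤ L := by linarith [dist_nonneg (x := z) (y := c.toFun n)]
  have hD0 : 0 ≤ D := dist_nonneg
  rcases (dist_nonneg (x := x) (y := c.toFun n)).eq_or_lt with h0 | hpos
  · have ht0 : t = 0 := by
      refine NNReal.coe_eq_zero.1 (le_antisymm ?_ t.2)
      linarith
    subst ht0
    have : x = z := dist_eq_zero.1 (by simpa using hz)
    rw [← this]; linarith
  have hpos : 0 < L := hpos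
  have hnL : |(n : ℝ) - L| ≤ D := by
    rw [← hn, abs_le]
    constructor
    · linarith [dist_triangle x (c.toFun 0) (c.toFun n)]
    · linarith [dist_triangle (c.toFun 0) x (c.toFun n), dist_comm x (c.toFun 0)]
  -- compare `z` with the point `c(m)` that divides `[c(0), c(n)]` in the same ratio
  set m : ℝ≥0 := n * t / ⟨L, hpos.le⟩ with hm
  have hmR : (m : ℝ) = n * t / L := by rw [hm]; rfl
  have htL1 : (t : ℝ) / L ≤ 1 := div_le_one_of_le₀ htL hpos.le
  have htL0 : 0 ≤ (t : ℝ) / L := by positivity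
  have hmn : (m : ℝ) ≤ n := by
    rw [hmR, mul_div_assoc]
    exact mul_le_of_le_one_right n.2 htL1
  have e1 : dist z (c.toFun m) ≤ (1 - t / L) * dist x (c.toFun 0) := by
    refine dist_le_mul (p := c.toFun n) (by linarith) (by linarith) ?_ ?_ ?_ ?_
    · rw [dist_comm _ z, dist_comm _ x, ← hL]; field_simp; linarith
    · rw [dist_comm _ x, dist_comm _ x, ← hL, hz]; field_simp; ring
    · rw [dist_comm _ (c.toFun 0), hn, c.dist_eq, abs_of_nonneg (by linarith), hmR]
      field_simp
    · rw [dist_comm _ (c.toFun 0), dist_comm _ (c.toFun 0), hn, c.dist_eq, NNReal.coe_zero,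
        zero_sub, abs_neg, NNReal.abs_eq, hmR]
      field_simp; ring
  have e2 : dist (c.toFun m) (c.toFun t) ≤ D := by
    rw [c.dist_eq, hmR, show (n : ℝ) * t / L - t = t / L * (n - L) by field_simp, abs_mul,
      abs_of_nonneg htL0]
    exact (mul_le_of_le_one_left (abs_nonneg _) htL1).trans hnL
  have := dist_triangle z (c.toFun m) (c.toFun t)
  nlinarith

/-- In a proper space, a closed convex set containing a ray contains a ray with the same endpoint
from each of its points: a limit of the segments from that point to points far out on the ray. -/
theorem exists_of_isClosed_of_geodConvex [ProperSpace X] {C : Set X} (hC : IsClosed C)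
    (hconv : GeodConvex C) (c : GeodRay X) (hc : ∀ t, c.toFun t ∈ C) {x : X} (hx : x ∈ C) :
    ∃ d : GeodRay X, d.endpoint = c.endpoint ∧ d.toFun 0 = x ∧ ∀ t, d.toFun t ∈ C := by
  choose γ h0 h1 hγ using fun n : ℕ => geodesic x (c.toFun n)
  have hev : ∀ t : ℝ≥0, ∀ᶠ n : ℕ in (hyperfilter ℕ : Filter ℕ),
      (t : ℝ) ∈ Icc 0 (dist x (c.toFun n)) := by
    intro t
    refine Nat.hyperfilter_le_atTop ?_
    filter_upwards [eventually_ge_atTop ⌈(t : ℝ) + dist x (c.toFun 0)⌉₊] with n hn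
    have hn' := Nat.ceil_le.1 hn
    have : dist (c.toFun 0) (c.toFun n) = n := by simp [c.dist_eq]
    refine ⟨t.2, ?_⟩
    linarith [dist_triangle (c.toFun 0) x (c.toFun n), dist_comm x (c.toFun 0)]
  have hdist : ∀ t : ℝ≥0, ∀ n : ℕ, (t : ℝ) ∈ Icc 0 (dist x (c.toFun n)) → dist x (γ n t) = t ∧
      dist x (γ n t) + dist (γ n t) (c.toFun n) = dist x (c.toFun n) := by
    intro t n ht
    have e1 := hγ n 0 ⟨le_rfl, dist_nonneg⟩ t ht
    have e2 := hγ n t ht _ ⟨dist_nonneg, le_rfl⟩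
    rw [h0, zero_sub, abs_neg, abs_of_nonneg ht.1] at e1
    rw [h1, abs_sub_comm, abs_of_nonneg (by linarith [ht.2])] at e2
    exact ⟨e1, by rw [e1, e2]; ring⟩
  -- limits along an ultrafilter exist for all `t` at once, by compactness of balls
  have hlim : ∀ t : ℝ≥0, ∃ a, Tendsto (fun n => γ n t) (hyperfilter ℕ : Filter ℕ) (𝓝 a) := by
    intro t
    obtain ⟨a, -, ha⟩ := (isCompact_closedBall x (t : ℝ)).ultrafilter_le_nhds
      ((hyperfilter ℕ).map fun n => γ n t) (by
        rw [Ultrafilter.coe_map, le_principal_iff, mem_map]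
        filter_upwards [hev t] with n hn
        rw [mem_preimage, Metric.mem_closedBall, dist_comm, (hdist t n hn).1])
    exact ⟨a, ha⟩
  choose f hf using hlim
  refine ⟨⟨f, Isometry.of_dist_eq fun s t => ?_⟩, Quotient.sound ⟨2 * dist x (c.toFun 0), ?_⟩,
    ?_, fun t => ?_⟩
  · refine tendsto_nhds_unique ((hf s).dist (hf t)) (tendsto_const_nhds.congr' ?_)
    filter_upwards [hev s, hev t] with n hs ht
    rw [hγ n s hs t ht, NNReal.dist_eq]
  · intro t
    refine le_of_tendsto ((hf t).dist tendsto_const_nhds) ?_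
    filter_upwards [hev t] with n hn
    exact c.dist_le_two_mul (hdist t n hn).1 (hdist t n hn).2
  · refine tendsto_nhds_unique (hf 0) (tendsto_const_nhds.congr fun n => ?_)
    rw [NNReal.coe_zero, h0]
  · refine hC.mem_of_tendsto (hf t) ?_
    filter_upwards [hev t] with n hn
    exact hconv x hx _ (hc n) _ (hdist t n hn).2

end GeodRay

section Boundary

open CAT0Space Filter

variable {X : Type*} [MetricSpace X]

theorem bdryOf_mono {A B : Set X} (h : A ⊆ B) : bdryOf A ⊆ bdryOf B :=
  fun _ ⟨c, hc, hA⟩ => ⟨c, hc, fun t => h (hA t)⟩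

theorem mem_bdryOf_or_mem_bdryOf {C D : Set X} (hC : GeodConvex C) (h : C ∪ D = univ)
    (ξ : BdryInf X) : ξ ∈ bdryOf C ∨ ξ ∈ bdryOf D := by
  induction ξ using Quotient.inductionOn with
  | h c =>
  by_cases hc : ∀ a, ∃ t ≥ a, c.toFun t ∈ C
  · obtain ⟨a, -, ha⟩ := hc 0
    refine Or.inl ⟨c.tail a, c.endpoint_tail a, fun t => ?_⟩
    obtain ⟨b, hb, hbC⟩ := hc (a + t)
    refine hC _ ha _ hbC _ ?_
    have hb' : (a : ℝ) + t ≤ b := by exact_mod_cast hb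
    change dist (c.toFun a) (c.toFun (a + t)) + dist (c.toFun (a + t)) (c.toFun b) = _
    simp only [c.dist_eq, NNReal.coe_add]
    have := t.2
    rw [abs_of_nonpos (by linarith), abs_of_nonpos (by linarith), abs_of_nonpos (by linarith)]
    ring
  · push Not at hc
    obtain ⟨a, ha⟩ := hc
    refine Or.inr ⟨c.tail a, c.endpoint_tail a, fun t => ?_⟩
    exact (h.symm ▸ mem_univ (c.toFun (a + t)) : c.toFun (a + t) ∈ C ∪ D).resolve_left
      (ha _ le_self_add)

variable [CAT0Space X] [ProperSpace X]

/-- For `ξ ∈ ∂∞ C`, with `C` closed and convex, every ray with endpoint `ξ` that starts in `C`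
stays in `C`. -/
theorem mem_of_endpoint_mem_bdryOf {C : Set X} (hC : IsClosed C) (hconv : GeodConvex C)
    {c : GeodRay X} (hc : c.endpoint ∈ bdryOf C) (h0 : c.toFun 0 ∈ C) (t : ℝ≥0) :
    c.toFun t ∈ C := by
  obtain ⟨d, hd, hdC⟩ := hc
  obtain ⟨e, he, he0, heC⟩ := d.exists_of_isClosed_of_geodConvex hC hconv hdC h0
  rw [← GeodRay.eq_of_endpoint_eq he0 (he.trans hd)]
  exact heC t

theorem exists_ray (x : X) (ξ : BdryInf X) :
    ∃ c : GeodRay X, c.endpoint = ξ ∧ c.toFun 0 = x := by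
  induction ξ using Quotient.inductionOn with
  | h c =>
    obtain ⟨d, hd, hd0, -⟩ := c.exists_of_isClosed_of_geodConvex isClosed_univ
      (fun _ _ _ _ _ _ => mem_univ _) (fun _ => mem_univ _) (mem_univ x)
    exact ⟨d, hd, hd0⟩

theorem bdryOf_inter {C D : Set X} (hC : IsClosed C) (hC' : GeodConvex C) (hD : IsClosed D)
    (hD' : GeodConvex D) (hne : (C ∩ D).Nonempty) : bdryOf (C ∩ D) = bdryOf C ∩ bdryOf D := by
  refine Subset.antisymm (subset_inter (bdryOf_mono inter_subset_left)
    (bdryOf_mono inter_subset_right)) ?_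
  rintro ξ ⟨h1, h2⟩
  obtain ⟨x, hx⟩ := hne
  obtain ⟨c, rfl, rfl⟩ := exists_ray x ξ
  exact ⟨c, rfl, fun t => ⟨mem_of_endpoint_mem_bdryOf hC hC' h1 hx.1 t,
    mem_of_endpoint_mem_bdryOf hD hD' h2 hx.2 t⟩⟩

/-- The boundary of a closed convex set is closed in the cone topology: a ray that leaves the set
has a basic neighbourhood of rays that leave it at about the same time. -/
theorem isClosed_bdryOf {C : Set X} (hC : IsClosed C) (hconv : GeodConvex C) :
    IsClosed (bdryOf C) := by
  rcases C.eq_empty_or_nonempty with rfl | ⟨x, hx⟩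
  · convert isClosed_empty
    exact eq_empty_of_forall_notMem fun ξ ⟨c, _, hc⟩ => hc 0
  rw [← isOpen_compl_iff, isOpen_iff_mem_nhds]
  intro ξ hξ
  obtain ⟨c, rfl, rfl⟩ := exists_ray x ξ
  obtain ⟨r, hr⟩ : ∃ r, c.toFun r ∉ C := by
    by_contra! h
    exact hξ ⟨c, rfl, h⟩
  have hr0 : 0 < r := pos_iff_ne_zero.2 fun h => hr (h ▸ hx)
  obtain ⟨ε, hε, hball⟩ := Metric.isOpen_iff.1 hC.isOpen_compl _ hr
  have hopen : IsOpen (coneNhd c r ε) :=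
    TopologicalSpace.isOpen_generateFrom_of_mem (Or.inr ⟨c, r, ε, hr0, hε, rfl⟩)
  refine mem_of_superset ((hopen.preimage continuous_induced_dom).mem_nhds
    ⟨c, rfl, rfl, by rwa [dist_self]⟩) ?_
  rintro η ⟨d, rfl, hd0, hd⟩ hη
  exact hball hd (mem_of_endpoint_mem_bdryOf hC hconv hη (hd0 ▸ hx) r)

end Boundary

/-! ### Ultrafilters on poc-sets -/

namespace PocSet

variable {H : Type*} [PocSet H]

theorem le_pstar_comm {h k : H} : h ≤ pstar k ↔ k ≤ pstar h := by
  constructor <;> intro hk <;> simpa only [pstar_pstar] using pstar_le_pstar _ _ hk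

namespace UF

theorem notMem_iff (α : UF H) {h : H} : h ∉ α.carrier ↔ pstar h ∈ α.carrier := by
  have := α.uf1 h
  unfold Xor at this
  tauto

/-- The ultrafilter obtained from `α` by forcing it to contain `T`, where `T` is closed upwards
and contains at most one of `h` and `h*` for each `h`. -/
def force (α : UF H) (T : Set H) (hup : IsUpperSet T) (hT : ∀ h ∈ T, pstar h ∉ T) : UF H where
  carrier := {h | h ∈ T ∨ h ∈ α.carrier ∧ pstar h ∉ T}
  uf1 h := by
    have h1 := hT h
    have h2 := α.notMem_iff (h := h)
    simp only [Xor, mem_ofPred_eq, pstar_pstar]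
    tauto
  uf2 := by
    rintro h (hh | ⟨hh, hh'⟩) k (hk | ⟨hk, hk'⟩) hle
    · exact hT k hk (hup hle hh)
    · exact hk' (hup hle hh)
    · exact hh' (hup (le_pstar_comm.1 hle) hk)
    · exact α.uf2 h hh k hk hle

theorem almostEq_of_finite_diff {α β : UF H} (h : (α.carrier \ β.carrier).Finite) : α ≈ β := by
  refine Set.Finite.union h ((h.image pstar).subset ?_)
  rintro k ⟨hk, hk'⟩
  refine ⟨pstar k, ⟨α.notMem_iff.1 hk', ?_⟩, pstar_pstar k⟩
  rw [β.notMem_iff, pstar_pstar]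
  exact hk

/-- The finite subsets of `σ` give a neighbourhood base at `σ`. -/
theorem mem_closure_iff {σ : UF H} {A : Set (UF H)} :
    σ ∈ closure A ↔ ∀ F : Set H, F.Finite → F ⊆ σ.carrier → ∃ α ∈ A, F ⊆ α.carrier := by
  rw [(TopologicalSpace.isTopologicalBasis_of_subbasis rfl).mem_closure_iff]
  constructor
  · intro h F hF hFσ
    have hsub : (fun h => {α : UF H | h ∈ α.carrier}) '' F ⊆
        {S | ∃ h : H, S = {α : UF H | h ∈ α.carrier}} := by
      rintro _ ⟨h, -, rfl⟩
      exact ⟨h, rfl⟩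
    obtain ⟨α, hα, hαA⟩ := h _ ⟨_, ⟨hF.image _, hsub⟩, rfl⟩
      (by rintro _ ⟨h, hh, rfl⟩; exact hFσ hh)
    exact ⟨α, hαA, fun h hh => hα _ ⟨h, hh, rfl⟩⟩
  · rintro h _ ⟨s, ⟨hs, hs'⟩, rfl⟩ hσ
    choose f hf using fun S : s => hs' S.2
    have := hs.to_subtype
    obtain ⟨α, hαA, hα⟩ := h (range f) (finite_range f) (by
      rintro _ ⟨S, rfl⟩
      have := hσ S.1 S.2
      rwa [hf S] at this)
    refine ⟨α, fun S hS => ?_, hαA⟩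
    have := hf ⟨S, hS⟩
    rw [show S = _ from this]
    exact hα ⟨_, rfl⟩

/-- Let all but finitely many of the elements above each `h ≠ ⊥` belong to `α`. Then the
ultrafilters almost equal to `α` that contain `T` are dense among all ultrafilters that
contain `T`. -/
theorem mem_closure_cls_force {α : UF H}
    (hα : ∀ h : H, h ≠ ⊥ → {k | h ≤ k ∧ k ∉ α.carrier}.Finite) {T : Set H} (hup : IsUpperSet T)
    (hT : ∀ h ∈ T, pstar h ∉ T) {σ : UF H} (hσ : T ⊆ σ.carrier) :
    σ ∈ closure (cls (α.force T hup hT)).toSet := by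
  refine mem_closure_iff.2 fun F hF hFσ => ?_
  have hsub : T ∪ ↑(upperClosure F) ⊆ σ.carrier := by
    refine union_subset hσ ?_
    rintro k ⟨h, hh, hle⟩
    exact σ.mem_of_le (hFσ hh) hle
  have hcons : ∀ h ∈ T ∪ ↑(upperClosure F), pstar h ∉ T ∪ ↑(upperClosure F) := fun h hh hh' =>
    σ.notMem_iff.2 (hsub hh') (hsub hh)
  refine ⟨α.force _ (hup.union (upperClosure F).upper) hcons, Quotient.sound ?_,
    fun h hh => Or.inl (Or.inr ⟨h, hh, le_rfl⟩)⟩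
  refine almostEq_of_finite_diff ((hF.biUnion (t := fun h => {k | h ≤ k ∧ k ∉ α.carrier})
    fun h hh => hα h ?_).subset ?_)
  · rintro rfl
    exact σ.uf2 _ (hFσ hh) _ (hFσ hh) bot_le
  · rintro k ⟨(hk | ⟨h, hh, hle⟩) | ⟨hk, hk'⟩, hk2⟩
    · exact absurd (Or.inl hk) hk2
    · refine mem_biUnion hh ⟨hle, fun hkα => hk2 (Or.inr ⟨hkα, fun hkT => ?_⟩)⟩
      exact hcons k (Or.inr ⟨h, hh, hle⟩) (Or.inl hkT)
    · exact absurd (Or.inr ⟨hk, fun h => hk' (Or.inl h)⟩) hk2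

/-- A set without a minimal element that is contained in some ultrafilter is contained in all the
almost equal ones, since each of its elements lies above an infinite descending chain. -/
theorem subset_of_almostEq {α β : UF H} (h : α ≈ β) {T : Set H} (hT : ∀ a ∈ T, ∃ b ∈ T, b < a)
    (hα : T ⊆ α.carrier) : T ⊆ β.carrier := by
  intro a ha
  have : NoMinOrder T := ⟨fun a => by
    obtain ⟨b, hb, hlt⟩ := hT a.1 a.2
    exact ⟨⟨b, hb⟩, hlt⟩⟩
  have : Nonempty T := ⟨⟨a, ha⟩⟩
  obtain ⟨f, hf, h0⟩ := Nat.exists_strictAnti' (⟨a, ha⟩ : T)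
  have h1 : (f 0).1 ∈ β.carrier :=
    UF.chains_subset α β h (a := ⟨fun n => (f n).1, hf⟩) (fun n => hα (f n).2) 0
  rwa [h0] at h1

theorem exists_mem_chains {α : UF H} {T : Set H} (hT : ∀ a ∈ T, ∃ b ∈ T, b < a)
    (hne : T.Nonempty) (hα : T ⊆ α.carrier) : α.chains.Nonempty := by
  have : NoMinOrder T := ⟨fun a => by
    obtain ⟨b, hb, hlt⟩ := hT a.1 a.2
    exact ⟨⟨b, hb⟩, hlt⟩⟩
  have := hne.to_subtype
  obtain ⟨f, hf⟩ := Nat.exists_strictAnti T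
  exact ⟨⟨fun n => (f n).1, hf⟩, fun n => hα (f n).2⟩

theorem IsPrincipal.chains_eq_empty {α : UF H} (h : α.IsPrincipal) : α.chains = ∅ := by
  refine eq_empty_of_forall_notMem fun c hc => ?_
  obtain ⟨N, hN⟩ := h c.1 hc fun n => c.2.antitone n.le_succ
  exact (c.2 N.lt_succ_self).ne (hN N le_rfl)

end UF

/-- Transverse elements of a poc-set. -/
def Transverse (h k : H) : Prop :=
  ¬ h ≤ k ∧ ¬ pstar h ≤ k ∧ ¬ h ≤ pstar k ∧ ¬ pstar h ≤ pstar k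

/-- Elements that distinguish two ultrafilters are comparable or transverse, so that Ramsey's
theorem yields a monotone sequence among infinitely many of them. -/
theorem UF.exists_strictMono_or_strictAnti
    (hH : ∀ S : Set H, S.Pairwise Transverse → S.Finite) {α β : UF H}
    (h : (α.carrier \ β.carrier).Infinite) :
    ∃ c : ℕ → H, (∀ n, c n ∈ α.carrier \ β.carrier) ∧ (StrictMono c ∨ StrictAnti c) := by
  have hf := (h.natEmbedding).injective
  set f := h.natEmbedding
  obtain ⟨g₁, h1⟩ := exists_increasing_or_nonincreasing_subseq (· < ·) fun n => (f n).1
  rcases h1 with h1 | h1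
  · exact ⟨fun n => (f (g₁ n)).1, fun n => (f (g₁ n)).2, Or.inl fun m n => h1 m n⟩
  obtain ⟨g₂, h2⟩ := exists_increasing_or_nonincreasing_subseq (· > ·) fun n => (f (g₁ n)).1
  rcases h2 with h2 | h2
  · exact ⟨fun n => (f (g₁ (g₂ n))).1, fun n => (f (g₁ (g₂ n))).2, Or.inr fun m n => h2 m n⟩
  have hinj : Function.Injective fun n => (f (g₁ (g₂ n))).1 :=
    Subtype.val_injective.comp (hf.comp (g₁.injective.comp g₂.injective))
  refine absurd (hH (range fun n => (f (g₁ (g₂ n))).1) ?_) (infinite_range_of_injective hinj)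
  have key : ∀ m n, m ≠ n → ¬ (f (g₁ (g₂ m))).1 ≤ (f (g₁ (g₂ n))).1 := by
    intro m n hmn hle
    rcases lt_or_gt_of_ne hmn with hlt | hlt
    · exact h1 _ _ (g₂.strictMono hlt) (lt_of_le_of_ne hle (hinj.ne hmn))
    · exact h2 n m hlt (lt_of_le_of_ne hle (hinj.ne hmn))
  rintro _ ⟨m, rfl⟩ _ ⟨n, rfl⟩ hmn
  have hmn : m ≠ n := fun e => hmn (by rw [e])
  have hm := (f (g₁ (g₂ m))).2
  have hn := (f (g₁ (g₂ n))).2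
  refine ⟨key m n hmn, fun hle => ?_, fun hle => α.uf2 _ hm.1 _ hn.1 hle, fun hle => ?_⟩
  · exact hn.2 (β.mem_of_le (β.notMem_iff.1 hm.2) hle)
  · exact key n m hmn.symm (by simpa only [pstar_pstar] using pstar_le_pstar _ _ hle)

/-! ### The Roller boundary -/

namespace Roller

theorem chains_subset_of_le {α σ : UF H} (h : cls α ≤ cls σ) : α.chains ⊆ σ.chains := by
  obtain ⟨τ, hτ, hτα⟩ := h
  suffices hsub : α.chains ⊆ τ.chains from
    hsub.trans (UF.chains_subset τ σ (Quotient.exact hτ))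
  intro c hc n
  by_contra hn
  obtain ⟨β, hβ, hβn⟩ := UF.mem_closure_iff.1 hτα {pstar (c.1 n)} (finite_singleton _)
    (singleton_subset_iff.2 (τ.notMem_iff.1 hn))
  exact β.notMem_iff.2 (hβn rfl) (UF.chains_subset α β (Setoid.symm (Quotient.exact hβ)) hc n)

/-- A class of codimension one has nothing below it but itself and principal classes. -/
theorem eq_of_le_of_codim_eq_one (hH : ∀ S : Set H, S.Pairwise Transverse → S.Finite)
    {α σ : UF H} (hle : cls α ≤ cls σ) (hα : α.chains.Nonempty) (hσ : (cls σ).codim = 1) :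
    cls α = cls σ := by
  refine Quotient.sound (UF.almostEq_of_finite_diff ?_)
  by_contra hinf
  obtain ⟨c, hc, hmono | hanti⟩ := UF.exists_strictMono_or_strictAnti hH hinf
  · obtain ⟨d, hd⟩ := hα
    -- the complements `c n*` form a descending chain in `σ`, which is equivalent to `d`
    have hc' : StrictAnti fun n => pstar (c n) := fun m n hmn =>
      lt_of_le_of_ne (pstar_le_pstar _ _ (hmono.monotone hmn.le)) fun e =>
        (hmono hmn).ne (by rw [← pstar_pstar (c m), ← pstar_pstar (c n)]; exact congrArg _ e.symm)
    have hsub := (Cardinal.le_one_iff_subsingleton.1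
      (le_of_eq hσ : Cardinal.mk ((Quotient.mk (Chain.setoid H)) '' σ.chains : Set _) ≤ 1))
    have e := congrArg Subtype.val (hsub.elim
      ⟨_, d, chains_subset_of_le hle hd, rfl⟩
      ⟨_, ⟨fun n => pstar (c n), hc'⟩, fun n => σ.notMem_iff.1 (hc n).2, rfl⟩)
    obtain ⟨hdom, -⟩ : d.Dominates ⟨fun n => pstar (c n), hc'⟩ ∧ _ := Quotient.exact e
    obtain ⟨n, hn⟩ := hdom 0
    exact α.uf2 _ (hd n) _ (hc 0).1 hn
  · exact (hc 0).2 (chains_subset_of_le hle (a := ⟨c, hanti⟩) (fun n => (hc n).1) 0)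

end Roller

end PocSet

/-! ### Halfspaces and walls -/

section Halfspace

open CAT0Space

variable {X : Type*} [MetricSpace X]

theorem closure_union_closure_hstar (h : Set X) : closure h ∪ closure (hstar h) = univ :=
  eq_univ_of_univ_subset ((union_compl_self (closure h)).symm.subset.trans
    (union_subset_union_right _ subset_closure))

theorem compl_wall {h : Set X} (hh : hstar (hstar h) = h) : (wall h)ᶜ = h ∪ hstar h := by
  rw [wall, compl_inter, union_comm]
  change hstar (hstar h) ∪ hstar h = _
  rw [hh]

theorem inter_wall_nonempty {h s : Set X} (hs : IsPreconnected s)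
    (h1 : (s ∩ closure h).Nonempty) (h2 : (s ∩ closure (hstar h)).Nonempty) :
    (s ∩ wall h).Nonempty :=
  isPreconnected_closed_iff.1 hs _ _ isClosed_closure isClosed_closure
    (by rw [closure_union_closure_hstar]; exact subset_univ s) h1 h2

variable [CAT0Space X]

/-- A halfspace is determined by its wall and any of its points: it is a connected component of
the complement of its wall. -/
theorem subset_of_wall_eq {h k : Set X} (hh : hstar (hstar h) = h) (hk : hstar (hstar k) = k)
    (hconv : GeodConvex h) (hopen : IsOpen k) (hw : wall h = wall k) (hne : (h ∩ k).Nonempty) :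
    h ⊆ k := by
  refine IsPreconnected.subset_left_of_subset_union hopen (v := hstar k)
    isClosed_closure.isOpen_compl
    (disjoint_compl_right_iff_subset.2 subset_closure) ?_ hne hconv.isPreconnected
  rw [← compl_wall hk, ← hw, compl_wall hh]
  exact subset_union_left

variable [ProperSpace X]

theorem bdryOf_wall {h : Set X} (hh : IsHalfspace h) :
    bdryOf (wall h) = bdryOf (closure h) ∩ bdryOf (closure (hstar h)) := by
  refine Subset.antisymm (subset_inter (bdryOf_mono inter_subset_left)
    (bdryOf_mono inter_subset_right)) fun ξ hξ => ?_
  obtain ⟨⟨c, -, hc⟩, ⟨d, -, hd⟩⟩ := id hξ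
  obtain ⟨s, -, hs, hcs, hds, -⟩ := exists_segment (c.toFun 0) (d.toFun 0)
  obtain ⟨x, -, hx⟩ := inter_wall_nonempty hs ⟨_, hcs, hc 0⟩ ⟨_, hds, hd 0⟩
  rw [wall, bdryOf_inter isClosed_closure hh.2.1.closure isClosed_closure hh.2.2.closure ⟨x, hx⟩]
  exact hξ

end Halfspace

/-! ### The boundary decomposition -/

namespace HalfspaceSystem

open CAT0Space PocSet

variable {X : Type*} [MetricSpace X]

theorem transverse_finite (H : HalfspaceSystem X) (S : Set H.carrier)
    (hS : S.Pairwise Transverse) : S.Finite := by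
  refine Set.Finite.of_finite_image (f := Subtype.val) (H.omegaDim _ ?_ ?_)
    Subtype.val_injective.injOn
  · rintro _ ⟨h, -, rfl⟩
    exact h.2
  · rintro _ ⟨h, hh, rfl⟩ _ ⟨k, hk, rfl⟩ hne
    exact hS hh hk fun e => hne (congrArg _ e)

theorem finite_walls_of_isCompact (H : HalfspaceSystem X) {s : Set X} (hs : IsCompact s) :
    {W : Set X | (∃ h ∈ H.carrier, W = wall h) ∧ (W ∩ s).Nonempty}.Finite := by
  refine hs.induction_on (p := fun s =>
    {W : Set X | (∃ h ∈ H.carrier, W = wall h) ∧ (W ∩ s).Nonempty}.Finite) ?_ ?_ ?_ ?_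
  · simp
  · intro s t hst ht
    exact ht.subset fun W hW => ⟨hW.1, hW.2.mono (inter_subset_inter_right _ hst)⟩
  · intro s t hs ht
    refine (hs.union ht).subset fun W hW => ?_
    rcases (inter_union_distrib_left W s t ▸ hW.2).imp fun _ h => h with ⟨x, hx | hx⟩
    · exact Or.inl ⟨hW.1, x, hx⟩
    · exact Or.inr ⟨hW.1, x, hx⟩
  · intro x _
    obtain ⟨U, hU, hfin⟩ := H.locallyFinite x
    exact ⟨U, mem_nhdsWithin_of_mem_nhds hU, hfin⟩

/-- Two points are separated by finitely many walls only. -/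
theorem finite_separating [CAT0Space X] (H : HalfspaceSystem X) (x y : X) :
    {k : H.carrier | y ∈ k.1 ∧ x ∉ k.1}.Finite := by
  obtain ⟨s, hs, hs', hx, hy, -⟩ := exists_segment x y
  refine Set.Finite.of_injOn (f := fun k => wall k.1) ?_ ?_ (H.finite_walls_of_isCompact hs)
  · rintro k ⟨hyk, hxk⟩
    refine ⟨⟨k.1, k.2, rfl⟩, ?_⟩
    rw [inter_comm]
    refine inter_wall_nonempty hs' ⟨y, hy, subset_closure hyk⟩ ⟨x, hx, ?_⟩
    by_contra hx'
    exact hxk (H.hstar_hstar k.1 k.2 ▸ hx' : x ∈ k.1)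
  · rintro k ⟨hyk, -⟩ l ⟨hyl, -⟩ hw
    have hk := H.hstar_hstar k.1 k.2
    have hl := H.hstar_hstar l.1 l.2
    exact Subtype.ext (Subset.antisymm
      (subset_of_wall_eq hk hl (H.isHalfspace _ k.2).2.1 (H.isHalfspace _ l.2).1 hw ⟨y, hyk, hyl⟩)
      (subset_of_wall_eq hl hk (H.isHalfspace _ l.2).2.1 (H.isHalfspace _ k.2).1 hw.symm
        ⟨y, hyl, hyk⟩))

/-- Some ultrafilter, namely one that contains every halfspace around a fixed point, contains all
but finitely many of the elements above any non-trivial halfspace. -/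
theorem exists_uf_finite_above [CAT0Space X] (H : HalfspaceSystem X) (ξ : BdryInf X) :
    ∃ α : UF H.carrier, ∀ h : H.carrier, h ≠ ⊥ → {k | h ≤ k ∧ k ∉ α.carrier}.Finite := by
  obtain ⟨S⟩ := H.nonempty_roller ξ
  obtain ⟨α₀, -⟩ := Quotient.exists_rep S
  obtain ⟨c, -⟩ := Quotient.exists_rep ξ
  set x := c.toFun 0
  refine ⟨α₀.force {h | x ∈ h.1} (fun h k hle hx => hle hx)
    fun h hx hx' => hx' (subset_closure hx), fun h hh => ?_⟩
  obtain ⟨y, hy⟩ : h.1.Nonempty := by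
    rw [nonempty_iff_ne_empty]
    exact fun e => hh (Subtype.ext e)
  exact (H.finite_separating x y).subset fun k hk => ⟨hk.1 hy, fun hx => hk.2 (Or.inl hx)⟩

theorem mem_bdryOf_closure_or [CAT0Space X] (H : HalfspaceSystem X) (h : H.carrier)
    (ξ : BdryInf X) :
    ξ ∈ bdryOf (closure h.1) ∨ ξ ∈ bdryOf (closure (pstar h).1) :=
  mem_bdryOf_or_mem_bdryOf (H.isHalfspace _ h.2).2.1.closure (closure_union_closure_hstar h.1) ξ

theorem IsConical.exists_lt {H : HalfspaceSystem X} {ξ : BdryInf X}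
    (h : H.IsConical ξ) : ∀ a ∈ H.T ξ, ∃ b ∈ H.T ξ, b < a := by
  intro a ha
  obtain ⟨b, hb, hlt, -⟩ := h.2 a ha univ Filter.univ_mem
  exact ⟨b, hb, hlt⟩

variable [CAT0Space X] [ProperSpace X] (H : HalfspaceSystem X) {ξ : BdryInf X}

/-- In contrast to the definition, this description of `T(ξ)` is an open condition on `ξ`. -/
theorem mem_T_iff {h : H.carrier} : h ∈ H.T ξ ↔ ξ ∉ bdryOf (closure (pstar h).1) := by
  change ξ ∈ bdryOf (closure h.1) \ bdryOf (wall h.1) ↔ ξ ∉ bdryOf (closure (hstar h.1))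
  rw [bdryOf_wall (H.isHalfspace _ h.2)]
  have : ξ ∈ bdryOf (closure h.1) ∨ ξ ∈ bdryOf (closure (hstar h.1)) := H.mem_bdryOf_closure_or h ξ
  simp only [mem_sdiff, mem_inter_iff]
  tauto

theorem isUpperSet_T : IsUpperSet (H.T ξ) := by
  intro h k hle hh
  rw [mem_T_iff] at hh ⊢
  have hle' : (pstar k).1 ⊆ (pstar h).1 := pstar_le_pstar _ _ hle
  exact fun hk => hh (bdryOf_mono (closure_mono hle') hk)

theorem pstar_notMem_T {h : H.carrier} (hh : h ∈ H.T ξ) : pstar h ∉ H.T ξ := by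
  rw [mem_T_iff] at hh ⊢
  rw [pstar_pstar]
  have := H.mem_bdryOf_closure_or h ξ
  tauto

theorem isOpen_setOf_mem_T (h : H.carrier) : IsOpen {ξ | h ∈ H.T ξ} := by
  simp only [mem_T_iff]
  exact (isClosed_bdryOf isClosed_closure
    (H.isHalfspace _ (pstar h).2).2.1.closure).isOpen_compl

theorem mem_ultrafiltersAt_iff {σ : UF H.carrier} :
    σ ∈ H.ultrafiltersAt ξ ↔ H.T ξ ⊆ σ.carrier := by
  constructor
  · intro hσ h hh
    by_contra hn
    exact H.mem_T_iff.1 hh (hσ _ (σ.notMem_iff.1 hn))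
  · intro hσ h hh
    by_contra hn
    refine σ.notMem_iff.2 (hσ (H.mem_T_iff.2 ?_)) hh
    rwa [pstar_pstar]

theorem exists_isLeast_rollerAt (ξ : BdryInf X) : ∃ S, IsLeast (H.rollerAt ξ) S := by
  obtain ⟨α, hα⟩ := H.exists_uf_finite_above ξ
  have hT : ∀ h ∈ H.T ξ, pstar h ∉ H.T ξ := fun _ => H.pstar_notMem_T
  refine ⟨cls (α.force (H.T ξ) H.isUpperSet_T hT),
    ⟨_, H.mem_ultrafiltersAt_iff.2 fun h hh => ?_, rfl⟩, ?_⟩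
  · exact Or.inl hh
  rintro _ ⟨σ, hσ, rfl⟩
  exact ⟨σ, rfl, UF.mem_closure_cls_force hα _ hT (H.mem_ultrafiltersAt_iff.1 hσ)⟩

theorem isLeast_rho (ξ : BdryInf X) : IsLeast (H.rollerAt ξ) (H.rho ξ) :=
  Classical.epsilon_spec (H.exists_isLeast_rollerAt ξ)

theorem exists_rho_eq_cls (ξ : BdryInf X) :
    ∃ σ : UF H.carrier, H.T ξ ⊆ σ.carrier ∧ H.rho ξ = cls σ := by
  obtain ⟨σ, hσ, e⟩ := (H.isLeast_rho ξ).1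
  exact ⟨σ, H.mem_ultrafiltersAt_iff.1 hσ, e.symm⟩

variable {H}

theorem IsConical.T_subset (h : H.IsConical ξ) {α : UF H.carrier} (hα : H.rho ξ = cls α) :
    H.T ξ ⊆ α.carrier := by
  obtain ⟨σ, hσ, e⟩ := H.exists_rho_eq_cls ξ
  exact UF.subset_of_almostEq (Quotient.exact (e.symm.trans hα)) h.exists_lt hσ

theorem IsConical.chains_nonempty (h : H.IsConical ξ) {α : UF H.carrier}
    (hα : H.rho ξ = cls α) : α.chains.Nonempty :=
  UF.exists_mem_chains h.exists_lt h.1 (h.T_subset hα)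

/-- If `a ∈ T(ξ)` then `a ∈ T(η)` for some `η` in the fibre, so that `a` belongs to every
element of `S`. Hence `S` itself lies in `ℜ(ξ)`, of which `ρ(ξ)` is the minimum. -/
theorem IsUniform.rho_le_of_mem_closure (hH : H.IsUniform) {S : Roller H.carrier}
    (hξ : ξ ∈ closure (H.rho ⁻¹' {S})) : H.rho ξ ≤ S := by
  obtain ⟨α, rfl⟩ := Quotient.exists_rep S
  refine (H.isLeast_rho ξ).2 ⟨α, H.mem_ultrafiltersAt_iff.2 fun a ha => ?_, rfl⟩
  obtain ⟨η, hη, hηS⟩ := mem_closure_iff.1 hξ _ (H.isOpen_setOf_mem_T a) ha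
  exact (hH η).T_subset hηS hη

end HalfspaceSystem

theorem mainTheorem3 {X : Type*} [MetricSpace X] [ProperSpace X] [CAT0Space X]
    (H : HalfspaceSystem X) (hH : H.IsUniform) :
    (∀ ξ : BdryInf X, IsLeast (H.rollerAt ξ) (H.rho ξ)) ∧
    (∀ S : PocSet.Roller H.carrier, S ∈ Set.range H.rho →
      closure (H.rho ⁻¹' {S}) ⊆ ⋃ S₁ ∈ {S₁ : PocSet.Roller H.carrier | S₁ ≤ S}, H.rho ⁻¹' {S₁}) ∧
    (∀ S : PocSet.Roller H.carrier, (∃ α ∈ S.toSet, α.IsPrincipal) → H.rho ⁻¹' {S} = ∅) ∧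
    (∀ S : PocSet.Roller H.carrier, S.codim = 1 → IsClosed (H.rho ⁻¹' {S})) := by
  refine ⟨H.isLeast_rho, fun S _ ξ hξ => ?_, ?_, fun S hS => ?_⟩
  · exact mem_biUnion (show H.rho ξ ≤ S from hH.rho_le_of_mem_closure hξ) rfl
  · rintro S ⟨α, rfl, hα⟩
    refine eq_empty_of_forall_notMem fun ξ hξ => ?_
    exact ((hH ξ).chains_nonempty hξ).ne_empty hα.chains_eq_empty
  · refine isClosed_of_closure_subset fun ξ hξ => ?_
    have hle := hH.rho_le_of_mem_closure hξ
    obtain ⟨α, -, hα⟩ := H.exists_rho_eq_cls ξ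
    obtain ⟨σ, rfl⟩ := Quotient.exists_rep S
    rw [hα] at hle
    exact hα.trans (PocSet.Roller.eq_of_le_of_codim_eq_one H.transverse_finite hle
      ((hH ξ).chains_nonempty hα) hS)
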